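/- Let $p$ be a prime, $k$ a perfect field of characteristic $p$, $S=k[x_1,\dots,x_n]$, let $I\subseteq S$ be an ideal generated by squarefree monomials, and let $R=S/I$ be the corresponding Stanley–Reisner ring. For $e\ge 0$ let $\mathcal C_e(R)$ be the set of $p^{-e}$-linear maps on $R$, i.e. additive maps $\psi:R\to R$ with $\psi(r^{p^e}m)=r\,\psi(m)$ for all $r,m\in R$; it is a right $R$-module via $(\psi\cdot r)(m)=\psi(rm)$. Put $\mathcal C(R)=\bigoplus_{e\ge 0}\mathcal C_e(R)$ and $\mathcal C_+(R)=\bigoplus_{e\ge 1}\mathcal C_e(R)$. For $d\in\mathbb N_0$ let $S_d\subseteq S$ be the $k$-span of the monomials $x^\alpha$ with $\max_j\alpha_j\le d$. A finite family of generators $m_1,\dots,m_t$ of an $S$-module $M$ induces the gauge $\delta:M\to\mathbb N_0\cup\{-\infty\}$ given by $\delta(0)=-\infty$ and, for $m\ne 0$, $\delta(m)=\min\{d : m\in S_dm_1+\dots+S_dm_t\}$. The standard gauge on $R$ is the one induced by the generator $1$. For $e\ge 1$ let $I^{[p^e]}$ be the ideal generated by the $p^e$-th powers of the elements of $I$. Let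 $\psi_e:S\to S$ be the additive map with $\psi_e(c\,x^\alpha)=c^{1/p^e}x^{(\alpha+\mathbf 1)/p^e-\mathbf 1}$ if $p^e\mid \alpha_j+1$ for all $j$, and $\psi_e(c\,x^\alpha)=0$ otherwise ($c\in k$). Let $\Gamma_e$ be the set of exponents $\gamma$ of the minimal monomial generators $x^\gamma$ of $(I^{[p^e]}:_S I)$ that do not lie in $I^{[p^e]}$. For $\gamma\in\Gamma_e$ the map $\psi_e\circ x^\gamma$ induces an element $\psi_{e,\gamma}\in\mathcal C_e(R)$. Then: 1. $\mathcal C(R)$ is gauge bounded: for each gauge $\delta$ on $R$ there are a set $\{\psi_i\in\mathcal C_{e_i}(R)\}_i$, $e_i\ge 1$, generating $\mathcal C_+(R)$ as a right $R$-module and a constant $K$ such that $\delta(\psi_i(r))\le \dfrac{\delta(r)}{p^{e_i}}+\dfrac{K}{p-1}$ for all $i$ and all $r\in R$. 2. The maps $\psi_{e,\gamma}$ with $e\ge 1$ and $\gamma\in\Gamma_e$ generate $\mathcal C_+(R)$ as a right $R$-module, and every $\gamma\in\Gamma_e$ has all its entries in $\{0,p^e-1,p^e\}$. 3. For the standard gauge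 $\delta$ of $R$, all $e\ge 1$, all $\gamma\in\Gamma_e$ and every real $K\ge \frac{p-1}{p^e}$, one has $\delta(\psi_{e,\gamma}(r))\le \dfrac{\delta(r)}{p^e}+\dfrac{K}{p-1}$ for all $r\in R$. In particular the uniform constant $K=1$ works for all $e$ and $\gamma$. -/

import Mathlib

open MvPolynomial
open scoped DirectSum

noncomputable section

namespace CartierAlgebra

/-! ### Cartier operators -/

/-- The group `C_e(R)` of `p^{-e}`-linear maps `R → R`: additive maps `ψ` with
`ψ (r ^ (p ^ e) * m) = r * ψ m`. -/
def cartierMaps (p e : ℕ) (R : Type*) [CommRing R] : AddSubgroup (R →+ R) where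
  carrier := {ψ | ∀ r m : R, ψ (r ^ p ^ e * m) = r * ψ m}
  zero_mem' := by intro r m; simp
  add_mem' := by
    intro a b ha hb r m
    simp only [Set.mem_ofPred_eq] at ha hb
    simp [ha, hb, mul_add]
  neg_mem' := by
    intro a ha r m
    simp only [Set.mem_ofPred_eq] at ha
    simp [ha]

/-- The right `R`-module structure on `C_e(R)`: `ψ · r` is the composite `ψ ∘ r`, that is
`(ψ · r) m = ψ (r * m)`. -/
instance cartierMapsModule (p e : ℕ) (R : Type*) [CommRing R] : Module Rᵐᵒᵖ (cartierMaps p e R) where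
  smul r ψ := ⟨ψ.1.comp (AddMonoidHom.mulLeft r.unop), by
    intro s m
    have h := ψ.2 s (r.unop * m)
    simp only [AddMonoidHom.comp_apply, AddMonoidHom.coe_mulLeft]
    rw [← h]; congr 1; ring⟩
  one_smul ψ := Subtype.ext (AddMonoidHom.ext fun m => congrArg ψ.1 (one_mul m))
  mul_smul r s ψ := Subtype.ext (AddMonoidHom.ext fun m =>
    congrArg ψ.1 (mul_assoc s.unop r.unop m))
  smul_zero r := Subtype.ext (AddMonoidHom.ext fun _ => rfl)
  smul_add r ψ φ := Subtype.ext (AddMonoidHom.ext fun _ => rfl)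
  add_smul r s ψ := Subtype.ext (AddMonoidHom.ext fun m =>
    (congrArg ψ.1 (add_mul r.unop s.unop m)).trans (map_add ψ.1 _ _))
  zero_smul ψ := Subtype.ext (AddMonoidHom.ext fun m =>
    (congrArg ψ.1 (zero_mul m)).trans (map_zero ψ.1))

theorem op_smul_apply (p e : ℕ) (R : Type*) [CommRing R] (r : R) (ψ : cartierMaps p e R) (m : R) :
    (MulOpposite.op r • ψ).1 m = ψ.1 (r * m) := rfl

/-- The positive part `C_+(R) = ⨁_{e ≥ 1} C_e(R)` of the algebra of Cartier operators,
a right `R`-module. -/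
abbrev CartierPos (p : ℕ) (R : Type*) [CommRing R] : Type _ :=
  ⨁ e : ℕ+, cartierMaps p (e : ℕ) R

/-- A set of homogeneous elements of `C_+(R)`, each one given with its degree, generates
`C_+(R)` as a right `R`-module. -/
def GeneratesPos (p : ℕ) {R : Type*} [CommRing R]
    (G : Set (Σ e : ℕ+, cartierMaps p (e : ℕ) R)) : Prop :=
  Submodule.span Rᵐᵒᵖ
    ((fun g => (DirectSum.of (fun e : ℕ+ => cartierMaps p (e : ℕ) R) g.1 g.2 : CartierPos p R)) '' G)
    = ⊤

/-! ### Gauges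

`restrictDegree (Fin n) k d` is the subspace `S_d` of `S = k[x_1, …, x_n]` spanned by the
monomials all of whose exponents are at most `d`. -/

/-- The piece `M_d = S_d · ⟨m_1, …, m_t⟩ = S_d m_1 + ⋯ + S_d m_t`. -/
def gaugeFiltration {k : Type*} [Field k] {n : ℕ} {M : Type*} [AddCommGroup M]
    [Module (MvPolynomial (Fin n) k) M] {t : ℕ} (m : Fin t → M) (d : ℕ) : Set M :=
  {x | ∃ s : Fin t → MvPolynomial (Fin n) k,
    (∀ i, s i ∈ restrictDegree (Fin n) k d) ∧ x = ∑ i, s i • m i}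

open Classical in
/-- The function `δ_M : M → ℕ ∪ {-∞}` induced by `m_1, …, m_t`: `δ_M 0 = -∞`, and for `x ≠ 0`,
`δ_M x` is the least `d` with `x ∈ M_d` (which exists when the `m_i` generate `M`). -/
def gaugeOf (k : Type*) [Field k] (n : ℕ) {M : Type*} [AddCommGroup M]
    [Module (MvPolynomial (Fin n) k) M] {t : ℕ} (m : Fin t → M) (x : M) : WithBot ℕ :=
  if x = 0 then ⊥ else ((sInf {d : ℕ | x ∈ gaugeFiltration (k := k) (n := n) m d} : ℕ) : WithBot ℕ)

/-- `δ` is a gauge on `M`: it is induced by a finite generating family of the `S`-module `M`. -/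
def IsGauge (k : Type*) [Field k] (n : ℕ) {M : Type*} [AddCommGroup M]
    [Module (MvPolynomial (Fin n) k) M] (δ : M → WithBot ℕ) : Prop :=
  ∃ (t : ℕ) (m : Fin t → M),
    Submodule.span (MvPolynomial (Fin n) k) (Set.range m) = ⊤ ∧ δ = gaugeOf k n m

/-- The standard gauge on `R = S / I`, induced by the generator `1`. -/
def standardGauge {k : Type*} [Field k] {n : ℕ} (I : Ideal (MvPolynomial (Fin n) k)) :
    (MvPolynomial (Fin n) k ⧸ I) → WithBot ℕ :=
  gaugeOf k n (fun _ : Fin 1 => (1 : MvPolynomial (Fin n) k ⧸ I))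

/-- The inequality `δ (ψ r) ≤ δ r / p ^ e + K / (p - 1)` for all `r`, in `ℝ ∪ {-∞}`
(the right-hand side is `-∞` when `δ r = -∞`). -/
def GaugeBound (p e : ℕ) {R : Type*} [CommRing R] (δ : R → WithBot ℕ)
    (ψ : cartierMaps p e R) (K : ℝ) : Prop :=
  ∀ r : R, (δ (ψ.1 r)).map (fun d : ℕ => (d : ℝ)) ≤
    (δ r).map (fun d : ℕ => (d : ℝ) / (p : ℝ) ^ e + K / ((p : ℝ) - 1))

/-- The Cartier algebra of `R` is gauge bounded: for each gauge `δ` on `R` there are homogeneous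
generators of the right `R`-module `C_+(R)` and a constant `K` such that
`δ (ψ r) ≤ δ r / p ^ e + K / (p - 1)` for each generator `ψ`, of degree `e`, and each `r`. -/
def IsGaugeBounded (p : ℕ) (k : Type*) [Field k] (n : ℕ) (R : Type*) [CommRing R]
    [Algebra (MvPolynomial (Fin n) k) R] : Prop :=
  ∀ δ : R → WithBot ℕ, IsGauge k n δ →
    ∃ (G : Set (Σ e : ℕ+, cartierMaps p (e : ℕ) R)) (K : ℝ),
      GeneratesPos p G ∧ ∀ g ∈ G, GaugeBound p g.1 δ g.2 K

/-! ### Stanley–Reisner rings and the operators `ψ_e ∘ x^γ` -/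

/-- `I` is generated by squarefree monomials. -/
def IsSquarefreeMonomialIdeal {k : Type*} [Field k] {n : ℕ}
    (I : Ideal (MvPolynomial (Fin n) k)) : Prop :=
  ∃ A : Set (Fin n →₀ ℕ), (∀ a ∈ A, ∀ i, a i ≤ 1) ∧
    I = Ideal.span ((fun a => monomial a (1 : k)) '' A)

section

variable (p : ℕ) [Fact p.Prime] {k : Type*} [Field k] [CharP k p] {n : ℕ}

/-- The Frobenius power `I^{[p^e]}`, generated by the `p^e`-th powers of the elements of `I`. -/
def frobPow (I : Ideal (MvPolynomial (Fin n) k)) (e : ℕ) : Ideal (MvPolynomial (Fin n) k) :=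
  Ideal.span ((fun f => f ^ p ^ e) '' (I : Set (MvPolynomial (Fin n) k)))

/-- The colon ideal `(I^{[p^e]} : I)`. -/
def frobColon (I : Ideal (MvPolynomial (Fin n) k)) (e : ℕ) : Ideal (MvPolynomial (Fin n) k) :=
  (frobPow p I e).colon (I : Set (MvPolynomial (Fin n) k))

/-- The exponents `γ` of the minimal monomial generators `x^γ` of `(I^{[p^e]} : I)` that do not lie
in `I^{[p^e]}`. -/
def genExponents (I : Ideal (MvPolynomial (Fin n) k)) (e : ℕ) : Set (Fin n →₀ ℕ) :=
  {γ | Minimal (fun β : Fin n →₀ ℕ => monomial β (1 : k) ∈ frobColon p I e) γ ∧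
    monomial γ (1 : k) ∉ frobPow p I e}

variable [PerfectField k]

open Classical in
/-- The map `ψ_e` on `S`: it sends `c x^α` to `c^{1/p^e} x^{(α + 1)/p^e - 1}` if `p^e` divides every
`α_j + 1`, and to `0` otherwise. -/
def psi (e : ℕ) : MvPolynomial (Fin n) k →+ MvPolynomial (Fin n) k :=
  (Finsupp.liftAddHom fun α : Fin n →₀ ℕ =>
    if ∀ j, p ^ e ∣ α j + 1 then
      (monomial (Finsupp.equivFunOnFinite.symm fun j => (α j + 1) / p ^ e - 1)
          : k →ₗ[k] MvPolynomial (Fin n) k).toAddMonoidHom.comp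
        (iterateFrobeniusEquiv k p e).symm.toAddMonoidHom
    else 0).comp
  (AddMonoidAlgebra.coeffAddEquiv : MvPolynomial (Fin n) k ≃+ ((Fin n →₀ ℕ) →₀ k)).toAddMonoidHom

open Classical in
theorem psi_monomial (e : ℕ) (α : Fin n →₀ ℕ) (c : k) :
    psi p e (monomial α c) =
      if ∀ j, p ^ e ∣ α j + 1 then
        monomial (Finsupp.equivFunOnFinite.symm fun j => (α j + 1) / p ^ e - 1)
          ((iterateFrobeniusEquiv k p e).symm c)
      else 0 := by
  have h1 : (AddMonoidAlgebra.coeffAddEquiv (monomial α c) : (Fin n →₀ ℕ) →₀ k) =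
      Finsupp.single α c := rfl
  simp only [psi, AddMonoidHom.comp_apply, AddEquiv.toAddMonoidHom_eq_coe, AddMonoidHom.coe_coe, h1,
    Finsupp.liftAddHom_apply_single]
  split_ifs <;> rfl

theorem psi_pow_mul (e : ℕ) (g f : MvPolynomial (Fin n) k) :
    psi p e (g ^ p ^ e * f) = g * psi p e f := by
  classical
  have hp : 0 < p ^ e := pow_pos (Fact.out : p.Prime).pos e
  induction f using MvPolynomial.induction_on' with
  | add f₁ f₂ h₁ h₂ => rw [mul_add, map_add, map_add, h₁, h₂, mul_add]
  | monomial α c =>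
    induction g using MvPolynomial.induction_on' with
    | add g₁ g₂ h₁ h₂ => rw [add_pow_expChar_pow, add_mul, map_add, h₁, h₂, add_mul]
    | monomial β b =>
      rw [monomial_pow, monomial_mul, psi_monomial, psi_monomial]
      have hd : ∀ j, (p ^ e ∣ (p ^ e • β + α) j + 1 ↔ p ^ e ∣ α j + 1) := by
        intro j
        simp only [Finsupp.add_apply, Finsupp.smul_apply, smul_eq_mul, add_assoc]
        exact Nat.dvd_add_right (dvd_mul_right _ _)
      simp only [hd]
      split_ifs with h
      · rw [monomial_mul]
        congr 1
        · congr 1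
          ext j
          have h1 : 1 ≤ (α j + 1) / p ^ e :=
            Nat.div_pos (Nat.le_of_dvd (Nat.succ_pos _) (h j)) hp
          simp only [Finsupp.add_apply, Finsupp.smul_apply, smul_eq_mul,
            Finsupp.equivFunOnFinite_symm_apply_apply, add_assoc]
          rw [Nat.mul_add_div hp]
          omega
        · rw [map_mul]
          congr 1
          rw [RingEquiv.symm_apply_eq]
          simp [iterateFrobenius_def]
      · rw [mul_zero]

theorem psi_mem (I : Ideal (MvPolynomial (Fin n) k)) (e : ℕ) {f : MvPolynomial (Fin n) k}
    (hf : f ∈ frobPow p I e) : psi p e f ∈ I := by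
  refine Submodule.span_induction (p := fun f _ => ∀ h, psi p e (h * f) ∈ I) ?_ ?_ ?_ ?_ hf 1
    |> fun h => by simpa using h
  · rintro _ ⟨f, hf, rfl⟩ h
    change psi p e (h * f ^ p ^ e) ∈ I
    rw [mul_comm, psi_pow_mul]
    exact I.mul_mem_right _ hf
  · intro h; simp
  · intro x y _ _ hx hy h
    rw [mul_add, map_add]
    exact I.add_mem (hx h) (hy h)
  · intro a x _ hx h
    rw [smul_eq_mul, ← mul_assoc]
    exact hx _

/-- For `g ∈ (I^{[p^e]} : I)`, the element of `C_e(S / I)` induced by `ψ_e ∘ g`. -/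
def psiQuot (I : Ideal (MvPolynomial (Fin n) k)) (e : ℕ) (g : MvPolynomial (Fin n) k)
    (hg : g ∈ frobColon p I e) : cartierMaps p e (MvPolynomial (Fin n) k ⧸ I) :=
  ⟨QuotientAddGroup.lift I.toAddSubgroup
      ((Ideal.Quotient.mk I).toAddMonoidHom.comp ((psi p e).comp (AddMonoidHom.mulLeft g)))
      (by
        intro f hf
        refine Ideal.Quotient.eq_zero_iff_mem.mpr (psi_mem p I e ?_)
        exact Submodule.mem_colon.mp hg f hf),
    by
      intro r m
      obtain ⟨a, rfl⟩ := Ideal.Quotient.mk_surjective r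
      obtain ⟨b, rfl⟩ := Ideal.Quotient.mk_surjective m
      rw [← map_pow, ← map_mul]
      change Ideal.Quotient.mk I (psi p e (g * (a ^ p ^ e * b))) =
        Ideal.Quotient.mk I a * Ideal.Quotient.mk I (psi p e (g * b))
      rw [mul_left_comm, psi_pow_mul, map_mul]⟩

theorem psiQuot_mk (I : Ideal (MvPolynomial (Fin n) k)) (e : ℕ) (g : MvPolynomial (Fin n) k)
    (hg : g ∈ frobColon p I e) (f : MvPolynomial (Fin n) k) :
    (psiQuot p I e g hg).1 (Ideal.Quotient.mk I f) = Ideal.Quotient.mk I (psi p e (g * f)) := rfl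

/-- The operator `ψ_{e,γ} ∈ C_e(S / I)` induced by `ψ_e ∘ x^γ`. -/
def psiGamma (I : Ideal (MvPolynomial (Fin n) k)) (e : ℕ) (γ : genExponents p I e) :
    cartierMaps p e (MvPolynomial (Fin n) k ⧸ I) :=
  psiQuot p I e (monomial γ.1 1) γ.2.1.prop

end

end CartierAlgebra

end

/-!
Write `q = p ^ e`. Since `k` is perfect, `S` is free over its subring of `q`-th powers with basis
the monomials `x ^ a`, `0 ≤ a j < q`, and `ψ_e` pairs this basis with the monomials
`x ^ (q - 1 - a)` as a dual basis (`psi_monomial_coExp_mul`). Two consequences give Fedder's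
description of `C_e(S / I)` (`exists_eq_psiQuot`): a Cartier operator of `S / I` is induced by
`ψ_e ∘ g` for the `g` with prescribed values `ψ_e (g * x ^ a)`, and `g` lies in `(I^{[q]} : I)`
because `I^{[q]}` is the largest ideal that `ψ_e` maps into `I` (`mem_frobPow_of_psi_mem`).

For `I` generated by the squarefree `x ^ a`, `a ∈ A`, the colon ideal is a monomial ideal: `x ^ β`
lies in it iff for every `a ∈ A` some `b ∈ A` has `q • b ≤ β + a`. Hence the operators `ψ_{e,γ}`
generate (`generatesPos_psiGamma`), and since all `a j` and `b j` are `0` or `1`, a minimal `β` has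
its entries in `{0, q - 1, q}` (`genExponents_apply`).

As the entries of `γ` are at most `q`, the operator `ψ_e ∘ x ^ γ` sends a monomial with exponents
at most `d` to one with exponents at most `(d + q + 1) / q - 1 = (d + 1) / q`, which is the bound
for the standard gauge. Every other gauge differs from the standard one by a bounded amount
(`exists_gaugeFiltration_shift`), so the bound carries over with a constant independent of `e`
and `γ`.
-/

namespace CartierAlgebra

/-! ### The colon ideal of a squarefree monomial ideal -/

section Generation

variable (p : ℕ) [Fact p.Prime] {k : Type*} [Field k] [CharP k p] {n : ℕ}

theorem frobPow_span_monomial (A : Set (Fin n →₀ ℕ)) (e : ℕ) :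
    frobPow p (Ideal.span ((fun a => monomial a (1 : k)) '' A)) e =
      Ideal.span ((fun a => monomial a (1 : k)) '' ((fun a => p ^ e • a) '' A)) := by
  -- the `p ^ e`-th powers of the elements of an ideal are its image under a ring homomorphism
  have key : frobPow p (Ideal.span ((fun a => monomial a (1 : k)) '' A)) e =
      (Ideal.span ((fun a => monomial a (1 : k)) '' A)).map
        (iterateFrobenius (MvPolynomial (Fin n) k) p e) := by
    simp only [frobPow, Ideal.map]
    congr 1
  rw [key, Ideal.map_span, Set.image_image, Set.image_image]
  congr 1
  refine Set.image_congr fun a _ => ?_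
  simp [iterateFrobenius_def, monomial_pow]

theorem mem_frobColon_iff (A : Set (Fin n →₀ ℕ)) (e : ℕ) (g : MvPolynomial (Fin n) k) :
    g ∈ frobColon p (Ideal.span ((fun a => monomial a (1 : k)) '' A)) e ↔
      ∀ β ∈ g.support, ∀ a ∈ A, ∃ b ∈ A, p ^ e • b ≤ β + a := by
  have h1 : g ∈ frobColon p (Ideal.span ((fun a => monomial a (1 : k)) '' A)) e ↔
      ∀ a ∈ A, g * monomial a 1 ∈ frobPow p (Ideal.span ((fun a => monomial a (1 : k)) '' A)) e := by
    rw [frobColon, Ideal.span, Submodule.colon_span, Submodule.mem_colon]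
    simp
  rw [h1, frobPow_span_monomial]
  simp only [mem_ideal_span_monomial_image, Set.exists_mem_image]
  constructor
  · intro h β hβ a ha
    refine h a ha (β + a) ?_
    rw [mem_support_iff, coeff_mul_monomial, mul_one]
    exact mem_support_iff.mp hβ
  · intro h a ha x hx
    have hx' := support_mul _ _ hx
    obtain ⟨β, hβ, c, hc, rfl⟩ := Finset.mem_add.mp hx'
    rw [Finset.mem_singleton.mp (support_monomial_subset hc)]
    exact h β hβ a ha

theorem monomial_mem_frobColon_iff (A : Set (Fin n →₀ ℕ)) (e : ℕ) (β : Fin n →₀ ℕ) :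
    monomial β (1 : k) ∈ frobColon p (Ideal.span ((fun a => monomial a (1 : k)) '' A)) e ↔
      ∀ a ∈ A, ∃ b ∈ A, p ^ e • b ≤ β + a := by
  rw [mem_frobColon_iff]
  simp

/-- Membership of `x ^ β` in the colon ideal is a matter of inequalities
`p ^ e * b j ≤ β j + a j` with `a j, b j ∈ {0, 1}`, which survive when an entry `β j < p ^ e - 1` is
lowered to `0`, or an entry `β j > p ^ e` to `p ^ e`. -/
theorem genExponents_apply {I : Ideal (MvPolynomial (Fin n) k)}
    (hI : IsSquarefreeMonomialIdeal I) (e : ℕ) {γ : Fin n →₀ ℕ} (hγ : γ ∈ genExponents p I e)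
    (j : Fin n) : γ j = 0 ∨ γ j = p ^ e - 1 ∨ γ j = p ^ e := by
  classical
  obtain ⟨A, hA, rfl⟩ := hI
  obtain ⟨⟨hmem, hmin⟩, -⟩ := hγ
  simp only [monomial_mem_frobColon_iff] at hmem hmin
  -- lowering the exponent `γ j` to `c` keeps `x ^ γ` in the colon ideal only if nothing changes
  have lower : ∀ c ≤ γ j, (∀ a ∈ A, ∀ b ∈ A, p ^ e * b j ≤ γ j + a j → p ^ e * b j ≤ c + a j) →
      γ j ≤ c := by
    intro c hc h
    have h1 : γ.update j c ≤ γ := by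
      intro i
      rw [Finsupp.coe_update, Function.update_apply]
      split_ifs with hi
      · rw [hi]; exact hc
      · exact le_rfl
    have h2 := hmin (y := γ.update j c) ?_ h1 j
    · simpa using h2
    · intro a ha
      obtain ⟨b, hb, hab⟩ := hmem a ha
      refine ⟨b, hb, fun i => ?_⟩
      have hi := hab i
      simp only [Finsupp.add_apply, Finsupp.smul_apply, smul_eq_mul, Finsupp.coe_update,
        Function.update_apply] at hi ⊢
      split_ifs with hij
      · subst hij; exact h a ha b hb hi
      · exact hi
  have h01 : ∀ b ∈ A, b j = 0 ∨ b j = 1 := fun b hb => by have := hA b hb j; omega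
  by_contra! hne
  obtain ⟨h0, h1, h2⟩ := hne
  rcases lt_or_ge (p ^ e) (γ j) with hlt | hle
  · have := lower (p ^ e) hlt.le (fun a _ b hb _ => by rcases h01 b hb with h | h <;> simp [h])
    omega
  · have := lower 0 (Nat.zero_le _) (fun a ha b hb hab => by
      have := hA a ha j
      rcases h01 b hb with h | h
      · simp [h]
      · rw [h] at hab; omega)
    omega

theorem genExponents_apply_le {I : Ideal (MvPolynomial (Fin n) k)}
    (hI : IsSquarefreeMonomialIdeal I) {e : ℕ}
    (γ : genExponents p I e) (j : Fin n) : γ.1 j ≤ p ^ e := by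
  rcases genExponents_apply p hI e γ.2 j with h | h | h <;> omega

variable [PerfectField k]

/-! ### Duality and Fedder's description of the Cartier operators -/

/-- The family `a`, with entries below `q`, as the exponent of a monomial. -/
noncomputable def lowExp {q : ℕ} (a : Fin n → Fin q) : Fin n →₀ ℕ :=
  Finsupp.equivFunOnFinite.symm fun j => (a j : ℕ)

/-- The exponent `q - 1 - a` complementary to `lowExp a`. -/
noncomputable def coExp {q : ℕ} (a : Fin n → Fin q) : Fin n →₀ ℕ :=
  Finsupp.equivFunOnFinite.symm fun j => q - 1 - (a j : ℕ)

/-- The monomials `x ^ coExp a` form the dual basis, with respect to `ψ_e`, of the basis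
`x ^ lowExp b` of `S` over its subring of `p ^ e`-th powers. -/
theorem psi_monomial_coExp_mul (e : ℕ) (a b : Fin n → Fin (p ^ e)) :
    psi p e (monomial (coExp a) (1 : k) * monomial (lowExp b) 1) = if a = b then 1 else 0 := by
  have hp : 0 < p ^ e := pow_pos (Fact.out : p.Prime).pos e
  rw [monomial_mul, psi_monomial, mul_one, map_one]
  have hsum : ∀ j, (coExp a + lowExp b) j + 1 + a j = p ^ e + b j := by
    intro j
    have := (a j).2
    simp only [coExp, lowExp, Finsupp.add_apply, Finsupp.equivFunOnFinite_symm_apply_apply]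
    omega
  by_cases hab : a = b
  · subst hab
    have h1 : ∀ j, (coExp a + lowExp a) j + 1 = p ^ e := fun j => by have := hsum j; omega
    rw [if_pos rfl, if_pos fun j => by rw [h1 j]]
    rw [← C_1, C_apply]
    congr 2
    ext j
    rw [Finsupp.equivFunOnFinite_symm_apply_apply, h1, Nat.div_self hp]
    rfl
  · rw [if_neg hab, if_neg]
    intro h
    apply hab
    ext j
    obtain ⟨c, hc⟩ := h j
    have h2 := hsum j
    rw [hc] at h2
    have ha := (a j).2
    have hb := (b j).2
    have h3 := congrArg (· % p ^ e) h2
    simpa [Nat.mul_add_mod, Nat.mod_eq_of_lt ha, Nat.mod_eq_of_lt hb] using h3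

theorem monomial_eq_pow_mul (e : ℕ) (β : Fin n →₀ ℕ) (c : k) :
    ∃ (g : MvPolynomial (Fin n) k) (a : Fin n → Fin (p ^ e)),
      monomial β c = g ^ p ^ e * monomial (lowExp a) 1 := by
  have hp : 0 < p ^ e := pow_pos (Fact.out : p.Prime).pos e
  refine ⟨monomial (Finsupp.equivFunOnFinite.symm fun j => β j / p ^ e)
    ((iterateFrobeniusEquiv k p e).symm c), fun j => ⟨β j % p ^ e, Nat.mod_lt _ hp⟩, ?_⟩
  rw [monomial_pow, monomial_mul, mul_one]
  congr 1
  · congr 1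
    ext j
    simp [lowExp, Nat.div_add_mod]
  · have := (iterateFrobeniusEquiv k p e).apply_symm_apply c
    rw [iterateFrobeniusEquiv_apply, iterateFrobenius_def] at this
    exact this.symm

/-- The expansion of a polynomial in the basis of `S` over its subring of `p ^ e`-th powers. -/
theorem eq_sum_psi_pow_mul (e : ℕ) (u : MvPolynomial (Fin n) k) :
    u = ∑ a : Fin n → Fin (p ^ e),
      psi p e (u * monomial (coExp a) 1) ^ p ^ e * monomial (lowExp a) 1 := by
  have hp : p ^ e ≠ 0 := (pow_pos (Fact.out : p.Prime).pos e).ne'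
  induction u using MvPolynomial.induction_on' with
  | add f g hf hg =>
    conv_lhs => rw [hf, hg]
    simp only [add_mul, map_add, add_pow_expChar_pow, Finset.sum_add_distrib]
  | monomial β c =>
    obtain ⟨g, b, h⟩ := monomial_eq_pow_mul p e β c
    rw [h]
    simp only [mul_assoc, psi_pow_mul]
    simp only [mul_comm (monomial (lowExp b) (1 : k)), psi_monomial_coExp_mul]
    simp [ite_pow, ite_mul, zero_pow hp]

/-- The converse of `psi_mem`: `I^{[p^e]}` is the largest ideal that `ψ_e` maps into `I`. -/
theorem mem_frobPow_of_psi_mem (I : Ideal (MvPolynomial (Fin n) k)) (e : ℕ)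
    {u : MvPolynomial (Fin n) k} (h : ∀ f, psi p e (u * f) ∈ I) : u ∈ frobPow p I e := by
  rw [eq_sum_psi_pow_mul p e u]
  exact Ideal.sum_mem _ fun a _ => Ideal.mul_mem_right _ _ (Ideal.subset_span ⟨_, h _, rfl⟩)

/-- Fedder's description of the Cartier operators of `S / I`: each one is induced by `ψ_e ∘ g` for
some `g ∈ (I^{[p^e]} : I)`. -/
theorem exists_eq_psiQuot (I : Ideal (MvPolynomial (Fin n) k)) (e : ℕ)
    (φ : cartierMaps p e (MvPolynomial (Fin n) k ⧸ I)) :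
    ∃ (g : MvPolynomial (Fin n) k) (hg : g ∈ frobColon p I e), φ = psiQuot p I e g hg := by
  have hp : p ^ e ≠ 0 := (pow_pos (Fact.out : p.Prime).pos e).ne'
  choose s hs using fun a : Fin n → Fin (p ^ e) =>
    Ideal.Quotient.mk_surjective (φ.1 (Ideal.Quotient.mk I (monomial (lowExp a) (1 : k))))
  -- by duality, `ψ_e ∘ g` takes the value `s b` at `x ^ lowExp b`
  set g : MvPolynomial (Fin n) k := ∑ a, s a ^ p ^ e * monomial (coExp a) 1 with hgdef
  have hφ : ∀ f, φ.1 (Ideal.Quotient.mk I f) = Ideal.Quotient.mk I (psi p e (g * f)) := by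
    intro f
    induction f using MvPolynomial.induction_on' with
    | add f₁ f₂ h₁ h₂ => simp only [map_add, mul_add, h₁, h₂]
    | monomial β c =>
      obtain ⟨h, b, hb⟩ := monomial_eq_pow_mul p e β c
      have hgb : psi p e (g * monomial (lowExp b) 1) = s b := by
        rw [hgdef, Finset.sum_mul, map_sum]
        simp only [mul_assoc, psi_pow_mul, psi_monomial_coExp_mul]
        simp
      rw [hb, mul_left_comm, psi_pow_mul, hgb, map_mul, map_pow, φ.2, map_mul, hs]
  have hg : g ∈ frobColon p I e := by
    refine Submodule.mem_colon.mpr fun f hf => mem_frobPow_of_psi_mem p I e fun h => ?_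
    rw [smul_eq_mul, mul_assoc, ← Ideal.Quotient.eq_zero_iff_mem, ← hφ,
      Ideal.Quotient.eq_zero_iff_mem.mpr (I.mul_mem_right h hf), map_zero]
  refine ⟨g, hg, Subtype.ext (AddMonoidHom.ext fun r => ?_)⟩
  obtain ⟨f, rfl⟩ := Ideal.Quotient.mk_surjective r
  rw [hφ, psiQuot_mk]

/-- The colon ideal is a monomial ideal, so Fedder's description leaves only the operators
`ψ_e ∘ x ^ γ` with `x ^ γ` a minimal generator; those with `x ^ γ ∈ I^{[p^e]}` vanish. -/
theorem eq_top_of_psiGamma_mem {I : Ideal (MvPolynomial (Fin n) k)}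
    (hI : IsSquarefreeMonomialIdeal I) (e : ℕ)
    (N : Submodule (MvPolynomial (Fin n) k ⧸ I)ᵐᵒᵖ
      (cartierMaps p e (MvPolynomial (Fin n) k ⧸ I)))
    (hN : ∀ γ, psiGamma p I e γ ∈ N) : N = ⊤ := by
  -- the ideal of those `g` for which `ψ_e ∘ g` induces an element of `N`
  let T : Ideal (MvPolynomial (Fin n) k) :=
    { carrier := {g | ∃ hg : g ∈ frobColon p I e, psiQuot p I e g hg ∈ N}
      zero_mem' := ⟨zero_mem _, by
        convert N.zero_mem
        refine Subtype.ext (AddMonoidHom.ext fun r => ?_)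
        obtain ⟨f, rfl⟩ := Ideal.Quotient.mk_surjective r
        simp [psiQuot_mk]⟩
      add_mem' := by
        rintro a b ⟨ha, ha'⟩ ⟨hb, hb'⟩
        refine ⟨add_mem ha hb, ?_⟩
        convert N.add_mem ha' hb'
        refine Subtype.ext (AddMonoidHom.ext fun r => ?_)
        obtain ⟨f, rfl⟩ := Ideal.Quotient.mk_surjective r
        simp [psiQuot_mk, add_mul]
      smul_mem' := by
        rintro c g ⟨hg, hg'⟩
        refine ⟨Ideal.mul_mem_left _ c hg, ?_⟩
        convert N.smul_mem (MulOpposite.op (Ideal.Quotient.mk I c)) hg'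
        refine Subtype.ext (AddMonoidHom.ext fun r => ?_)
        obtain ⟨f, rfl⟩ := Ideal.Quotient.mk_surjective r
        rw [op_smul_apply, ← map_mul, psiQuot_mk, psiQuot_mk, smul_eq_mul, mul_assoc,
          mul_left_comm] }
  have hT : frobColon p I e ≤ T := by
    intro g hg
    rw [g.as_sum]
    refine Ideal.sum_mem _ fun β hβ => ?_
    have hβ' : monomial β (1 : k) ∈ frobColon p I e := by
      obtain ⟨A, -, rfl⟩ := hI
      exact (monomial_mem_frobColon_iff p A e β).mpr ((mem_frobColon_iff p A e g).mp hg β hβ)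
    obtain ⟨γ, hγβ, hγ⟩ := exists_minimal_le_of_wellFoundedLT
      (fun β : Fin n →₀ ℕ => monomial β (1 : k) ∈ frobColon p I e) β hβ'
    have hγT : monomial γ (1 : k) ∈ T := by
      refine ⟨hγ.prop, ?_⟩
      by_cases hmem : monomial γ (1 : k) ∈ frobPow p I e
      · convert N.zero_mem
        refine Subtype.ext (AddMonoidHom.ext fun r => ?_)
        obtain ⟨f, rfl⟩ := Ideal.Quotient.mk_surjective r
        rw [psiQuot_mk]
        exact Ideal.Quotient.eq_zero_iff_mem.mpr (psi_mem p I e (Ideal.mul_mem_right _ _ hmem))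
      · exact hN ⟨γ, hγ, hmem⟩
    have : monomial β (coeff β g) = monomial (β - γ) (coeff β g) * monomial γ (1 : k) := by
      rw [monomial_mul, mul_one, tsub_add_cancel_of_le hγβ]
    rw [this]
    exact Ideal.mul_mem_left _ _ hγT
  refine eq_top_iff.mpr fun φ _ => ?_
  obtain ⟨g, hg, rfl⟩ := exists_eq_psiQuot p I e φ
  exact (hT hg).2

theorem generatesPos_psiGamma {I : Ideal (MvPolynomial (Fin n) k)}
    (hI : IsSquarefreeMonomialIdeal I) :
    GeneratesPos p {g : Σ e : ℕ+, cartierMaps p (e : ℕ) (MvPolynomial (Fin n) k ⧸ I) |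
      ∃ γ : genExponents p I g.1, g.2 = psiGamma p I g.1 γ} := by
  classical
  refine eq_top_iff.mpr fun x _ => ?_
  induction x using DirectSum.induction_on with
  | zero => exact zero_mem _
  | add x y hx hy => exact add_mem (hx trivial) (hy trivial)
  | of e φ =>
    set G : Set (Σ e : ℕ+, cartierMaps p (e : ℕ) (MvPolynomial (Fin n) k ⧸ I)) :=
      {g | ∃ γ : genExponents p I g.1, g.2 = psiGamma p I g.1 γ}
    have h := eq_top_of_psiGamma_mem p hI e
      (Submodule.comap (DirectSum.lof (MvPolynomial (Fin n) k ⧸ I)ᵐᵒᵖ ℕ+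
        (fun e : ℕ+ => cartierMaps p (e : ℕ) (MvPolynomial (Fin n) k ⧸ I)) e)
        (Submodule.span _ ((fun g => DirectSum.of _ g.1 g.2) '' G)))
      (fun γ => Submodule.subset_span ⟨⟨e, psiGamma p I e γ⟩, ⟨γ, rfl⟩, rfl⟩)
    exact h.ge (Submodule.mem_top (x := φ))

end Generation

/-! ### Gauges -/

section Gauge

variable {k : Type*} [Field k] {n : ℕ}

theorem mul_mem_restrictDegree {d d' : ℕ} {f g : MvPolynomial (Fin n) k}
    (hf : f ∈ restrictDegree (Fin n) k d) (hg : g ∈ restrictDegree (Fin n) k d') :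
    f * g ∈ restrictDegree (Fin n) k (d + d') := by
  rw [mem_restrictDegree] at *
  intro s hs i
  obtain ⟨a, ha, b, hb, rfl⟩ := Finset.mem_add.mp (support_mul _ _ hs)
  exact add_le_add (hf a ha i) (hg b hb i)

theorem exists_mem_restrictDegree {ι : Type*} [Fintype ι] (f : ι → MvPolynomial (Fin n) k) :
    ∃ d, ∀ i, f i ∈ restrictDegree (Fin n) k d := by
  refine ⟨∑ i, (f i).totalDegree, fun i => ?_⟩
  rw [mem_restrictDegree]
  intro s hs j
  calc s j ≤ s.degree := Finsupp.le_degree j s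
    _ ≤ (f i).totalDegree := le_totalDegree hs
    _ ≤ _ := Finset.single_le_sum (f := fun i => (f i).totalDegree) (fun _ _ => Nat.zero_le _)
      (Finset.mem_univ i)

variable {M : Type*} [AddCommGroup M] [Module (MvPolynomial (Fin n) k) M] {t : ℕ} {m : Fin t → M}

theorem gaugeOf_le {x : M} {d : ℕ} (hx : x ∈ gaugeFiltration (k := k) (n := n) m d) :
    gaugeOf k n m x ≤ d := by
  unfold gaugeOf
  split_ifs
  · exact bot_le
  · exact_mod_cast Nat.sInf_le hx

theorem exists_mem_gaugeFiltration
    (hm : Submodule.span (MvPolynomial (Fin n) k) (Set.range m) = ⊤) (x : M) :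
    ∃ d, x ∈ gaugeFiltration (k := k) (n := n) m d := by
  obtain ⟨s, hs⟩ := (Submodule.mem_span_range_iff_exists_fun _).mp
    (hm.ge (Submodule.mem_top (x := x)))
  obtain ⟨d, hd⟩ := exists_mem_restrictDegree s
  exact ⟨d, s, hd, hs.symm⟩

theorem gaugeOf_eq_coe (hm : Submodule.span (MvPolynomial (Fin n) k) (Set.range m) = ⊤)
    {x : M} (hx : x ≠ 0) :
    ∃ d : ℕ, gaugeOf k n m x = d ∧ x ∈ gaugeFiltration (k := k) (n := n) m d := by
  rw [gaugeOf, if_neg hx]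
  exact ⟨_, rfl, Nat.sInf_mem (exists_mem_gaugeFiltration hm x)⟩

variable {I : Ideal (MvPolynomial (Fin n) k)}

theorem mk_eq_smul_one (f : MvPolynomial (Fin n) k) :
    Ideal.Quotient.mk I f = f • (1 : MvPolynomial (Fin n) k ⧸ I) := by
  change _ = Ideal.Quotient.mk I (f • 1)
  rw [smul_eq_mul, mul_one]

theorem mem_gaugeFiltration_one {x : MvPolynomial (Fin n) k ⧸ I} {d : ℕ} :
    x ∈ gaugeFiltration (k := k) (n := n) (fun _ : Fin 1 => (1 : MvPolynomial (Fin n) k ⧸ I)) d ↔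
      ∃ f ∈ restrictDegree (Fin n) k d, Ideal.Quotient.mk I f = x := by
  constructor
  · rintro ⟨s, hs, rfl⟩
    exact ⟨s 0, hs 0, by simp [mk_eq_smul_one]⟩
  · rintro ⟨f, hf, rfl⟩
    exact ⟨fun _ => f, fun _ => hf, by simp [mk_eq_smul_one]⟩

theorem span_range_one : Submodule.span (MvPolynomial (Fin n) k)
    (Set.range fun _ : Fin 1 => (1 : MvPolynomial (Fin n) k ⧸ I)) = ⊤ := by
  refine eq_top_iff.mpr fun x _ => ?_
  obtain ⟨f, rfl⟩ := Ideal.Quotient.mk_surjective x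
  rw [Set.range_const, Submodule.mem_span_singleton]
  exact ⟨f, (mk_eq_smul_one f).symm⟩

/-- Any two gauges of `S / I` differ by a bounded amount; here one of them is the standard one. -/
theorem exists_gaugeFiltration_shift {t : ℕ} {m : Fin t → MvPolynomial (Fin n) k ⧸ I}
    (hm : Submodule.span (MvPolynomial (Fin n) k) (Set.range m) = ⊤) :
    ∃ b c : ℕ,
      (∀ d, ∀ f ∈ restrictDegree (Fin n) k d,
        Ideal.Quotient.mk I f ∈ gaugeFiltration (k := k) (n := n) m (d + b)) ∧
      ∀ d, ∀ x ∈ gaugeFiltration (k := k) (n := n) m d,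
        ∃ f ∈ restrictDegree (Fin n) k (d + c), Ideal.Quotient.mk I f = x := by
  obtain ⟨b, s, hs, h1⟩ := exists_mem_gaugeFiltration hm (1 : MvPolynomial (Fin n) k ⧸ I)
  choose g hg using fun i => Ideal.Quotient.mk_surjective (m i)
  obtain ⟨c, hc⟩ := exists_mem_restrictDegree g
  refine ⟨b, c, fun d f hf => ⟨fun i => f * s i, fun i => mul_mem_restrictDegree hf (hs i), ?_⟩, ?_⟩
  · rw [mk_eq_smul_one, h1, Finset.smul_sum]
    simp only [mul_smul]
  · rintro d _ ⟨u, hu, rfl⟩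
    refine ⟨∑ i, u i * g i,
      Submodule.sum_mem _ fun i _ => mul_mem_restrictDegree (hu i) (hc i), ?_⟩
    rw [map_sum]
    refine Finset.sum_congr rfl fun i _ => ?_
    rw [map_mul, hg, mk_eq_smul_one, smul_mul_assoc, one_mul]

variable (p : ℕ) [Fact p.Prime] [CharP k p] [PerfectField k]

/-- An operator `ψ_e ∘ x ^ γ` with all entries of `γ` at most `p ^ e` maps `S_d` into `S_{d'}`, where
`d' = ⌊(d + 1) / p ^ e⌋`. -/
theorem psi_monomial_mul_mem (e : ℕ) {γ : Fin n →₀ ℕ} (hγ : ∀ j, γ j ≤ p ^ e) {d : ℕ}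
    {f : MvPolynomial (Fin n) k} (hf : f ∈ restrictDegree (Fin n) k d) :
    psi p e (monomial γ 1 * f) ∈ restrictDegree (Fin n) k ((d + 1) / p ^ e) := by
  have hp : 0 < p ^ e := pow_pos (Fact.out : p.Prime).pos e
  rw [f.as_sum, Finset.mul_sum, map_sum]
  refine Submodule.sum_mem _ fun α hα => ?_
  rw [monomial_mul, psi_monomial]
  split_ifs with h
  · rw [mem_restrictDegree]
    intro s hs i
    rw [Finset.mem_singleton.mp (support_monomial_subset hs)]
    have h1 := (mem_restrictDegree _ _ _ |>.mp hf) α hα i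
    simp only [Finsupp.equivFunOnFinite_symm_apply_apply, Finsupp.add_apply]
    have h2 : (γ i + α i + 1) / p ^ e ≤ (d + 1 + p ^ e) / p ^ e :=
      Nat.div_le_div_right (by have := hγ i; omega)
    rw [Nat.add_div_right _ hp] at h2
    exact Nat.sub_le_iff_le_add.mpr h2
  · exact Submodule.zero_mem _

/-- The gauge bound for a gauge that exceeds the standard gauge by at most `b` and falls below it
by at most `c`. -/
theorem gaugeBound_psiGamma {t : ℕ} {m : Fin t → MvPolynomial (Fin n) k ⧸ I}
    (hm : Submodule.span (MvPolynomial (Fin n) k) (Set.range m) = ⊤) {b c : ℕ}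
    (hb : ∀ d, ∀ f ∈ restrictDegree (Fin n) k d,
      Ideal.Quotient.mk I f ∈ gaugeFiltration (k := k) (n := n) m (d + b))
    (hc : ∀ d, ∀ x ∈ gaugeFiltration (k := k) (n := n) m d,
      ∃ f ∈ restrictDegree (Fin n) k (d + c), Ideal.Quotient.mk I f = x)
    {e : ℕ} {γ : genExponents p I e} (hγ : ∀ j, γ.1 j ≤ p ^ e) {K : ℝ}
    (hK : b + (c + 1) / (p : ℝ) ^ e ≤ K / ((p : ℝ) - 1)) :
    GaugeBound p e (gaugeOf k n m) (psiGamma p I e γ) K := by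
  intro r
  by_cases hr : r = 0
  · simp [hr, gaugeOf]
  obtain ⟨d, hd, hrd⟩ := gaugeOf_eq_coe hm hr
  obtain ⟨f, hf, rfl⟩ := hc d r hrd
  by_cases hψ : (psiGamma p I e γ).1 (Ideal.Quotient.mk I f) = 0
  · simp [hψ, gaugeOf]
  obtain ⟨d', hd', -⟩ := gaugeOf_eq_coe hm hψ
  have hle : gaugeOf k n m ((psiGamma p I e γ).1 (Ideal.Quotient.mk I f)) ≤ _ :=
    gaugeOf_le (hb _ _ (psi_monomial_mul_mem p e hγ hf))
  rw [hd', Nat.cast_le] at hle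
  rw [hd, hd', WithBot.map_natCast, WithBot.map_natCast, WithBot.coe_le_coe,
    Nat.cast_id, Nat.cast_id]
  calc (d' : ℝ) ≤ ((d + c + 1) / p ^ e : ℕ) + b := by exact_mod_cast hle
    _ ≤ (d + c + 1 : ℕ) / ((p ^ e : ℕ) : ℝ) + b := by gcongr; exact Nat.cast_div_le
    _ = d / (p : ℝ) ^ e + (b + (c + 1) / (p : ℝ) ^ e) := by push_cast; ring
    _ ≤ _ := by gcongr

theorem gaugeBound_standardGauge {e : ℕ} {γ : genExponents p I e} (hγ : ∀ j, γ.1 j ≤ p ^ e)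
    {K : ℝ} (hK : ((p : ℝ) - 1) / (p : ℝ) ^ e ≤ K) :
    GaugeBound p e (standardGauge I) (psiGamma p I e γ) K := by
  have hp1 : (0 : ℝ) < (p : ℝ) - 1 := sub_pos.mpr (mod_cast (Fact.out : p.Prime).one_lt)
  refine gaugeBound_psiGamma p span_range_one (b := 0) (c := 0)
    (fun d f hf => mem_gaugeFiltration_one.mpr ⟨f, hf, rfl⟩)
    (fun d x hx => mem_gaugeFiltration_one.mp hx) hγ ?_
  rw [le_div_iff₀ hp1]
  refine le_of_eq_of_le ?_ hK
  push_cast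
  ring

theorem isGaugeBounded_quotient (hI : IsSquarefreeMonomialIdeal I) :
    IsGaugeBounded p k n (MvPolynomial (Fin n) k ⧸ I) := by
  have hp1 : (0 : ℝ) < (p : ℝ) - 1 := sub_pos.mpr (mod_cast (Fact.out : p.Prime).one_lt)
  rintro _ ⟨t, m, hm, rfl⟩
  obtain ⟨b, c, hb, hc⟩ := exists_gaugeFiltration_shift hm
  refine ⟨_, (b + (c + 1)) * ((p : ℝ) - 1), generatesPos_psiGamma p hI, ?_⟩
  rintro g ⟨γ, hγ⟩
  rw [hγ]
  refine gaugeBound_psiGamma p hm hb hc (genExponents_apply_le p hI γ) ?_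
  rw [mul_div_cancel_right₀ _ hp1.ne']
  gcongr
  exact div_le_self (by positivity) (one_le_pow₀ (mod_cast (Fact.out : p.Prime).one_le))

end Gauge

end CartierAlgebra

theorem proposition5p3 (p : ℕ) [Fact p.Prime] (k : Type*) [Field k] [CharP k p] [PerfectField k]
    (n : ℕ) (I : Ideal (MvPolynomial (Fin n) k))
    (hI : CartierAlgebra.IsSquarefreeMonomialIdeal I) :
    -- the Cartier algebra of `S / I` is gauge bounded
    CartierAlgebra.IsGaugeBounded p k n (MvPolynomial (Fin n) k ⧸ I) ∧
    -- the operators `ψ_{e,γ}`, `e ≥ 1`, generate its positive part as a right module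
    CartierAlgebra.GeneratesPos p
      {g : Σ e : ℕ+, CartierAlgebra.cartierMaps p (e : ℕ) (MvPolynomial (Fin n) k ⧸ I) |
        ∃ γ : CartierAlgebra.genExponents p I g.1, g.2 = CartierAlgebra.psiGamma p I g.1 γ} ∧
    -- the exponents that occur, and the bound for the standard gauge
    ∀ e : ℕ, 1 ≤ e → ∀ γ : CartierAlgebra.genExponents p I e,
      (∀ j, γ.1 j = 0 ∨ γ.1 j = p ^ e - 1 ∨ γ.1 j = p ^ e) ∧
      ∀ K : ℝ, ((p : ℝ) - 1) / (p : ℝ) ^ e ≤ K →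
        CartierAlgebra.GaugeBound p e (CartierAlgebra.standardGauge I)
          (CartierAlgebra.psiGamma p I e γ) K := by
  open CartierAlgebra in
  exact ⟨isGaugeBounded_quotient p hI, generatesPos_psiGamma p hI, fun e _ γ =>
    ⟨genExponents_apply p hI e γ.2, fun _ hK =>
      gaugeBound_standardGauge p (genExponents_apply_le p hI γ) hK⟩⟩
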